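/- Let $\sigma=(p_1,\dots,p_l;m_1,\dots,m_l)$ be the spectrum of a density operator: $p_1>\dots>p_l>0$ are its different positive eigenvalues and $m_1,\dots,m_l\geq 1$ their multiplicities, with $\sum_j m_jp_j=1$. Let $k=\sum_j m_j$, let $\mathcal K$ be a Hilbert space with orthonormal basis $|1\rangle,\dots,|k\rangle$, and let $P(\sigma)=\sum_j p_j\Pi_j$, where $\Pi_j$ is the orthogonal projection on the span of the $|i\rangle$ with $m_1+\dots+m_{j-1}<i\leq m_1+\dots+m_j$. Let $\mathcal H$ be a finite-dimensional Hilbert space with real Lie algebra $\mathfrak u(\mathcal H)$ of anti-Hermitian operators, and let $\mathcal S(\sigma)$ be the set of all linear $\psi:\mathcal K\to\mathcal H$ with $\psi^\dagger\psi=P(\sigma)$, with the Riemannian metric induced by $G(X,Y)=\frac12\operatorname{Tr}(X^\dagger Y+Y^\dagger X)$. Put $\pi(\psi)=\psi\psi^\dagger$. A tangent vector of $\mathcal S(\sigma)$ is vertical if it lies in $\operatorname{Ker}d\pi$, and horizontal if it is $G$-orthogonal to all vertical vectors at the same point; a curve is horizontal if all its velocity vectors are. Let $\psi_0\in\mathcal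 S(\sigma)$, and assume that $\rho_0=\psi_0\psi_0^\dagger$ is invertible (so that all density operators on $\mathcal H$ with spectrum $\sigma$ are invertible, and $\dim\mathcal H=k$; one may take $\mathcal K=\mathcal H$). Let $\hbar>0$ and $\tau>0$. All curves are smooth and defined on $0\leq t\leq\tau$. For a curve $\xi$ in $\mathfrak u(\mathcal H)$ put $$\hat H_\xi(t)=i\hbar\,\exp_-\Big(\int_0^t\xi\,ds\Big)\,\xi(t)\,\exp_+\Big(-\int_0^t\xi\,ds\Big),$$ where $\exp_-$ and $\exp_+$ are the negative and positive time-ordered exponentials (factors with later times to the right and to the left, respectively), and consider the Schrödinger equation $$i\hbar\,\dot\psi=\hat H_\xi\,\psi,\qquad \psi(0)=\psi_0.\tag{1}$$ On $\mathfrak u(\mathcal H)$ let $\xi\ast\eta=-\frac12\operatorname{Tr}((\xi\eta+\eta\xi)\rho_0)$, and let $\operatorname{ad}^*_\xi\xi$ be the unique element of $\mathfrak u(\mathcal H)$ with $\operatorname{ad}^*_\xi\xi\ast\eta=\xi\ast[\xi,\eta]$ for all $\eta\in\mathfrak u(\mathcal H)$. For $\xi\in\mathfrak u(\mathcal H)$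 let $X_\xi(\psi)=\frac{d}{ds}\big[\exp(s\xi)\psi\big]_{s=0}$. Theorem 6 (label geodesics). Every curve in $\mathcal S(\sigma)$ that extends from $\psi_0$ is the solution to (1) for some curve $\xi$ in $\mathfrak u(\mathcal H)$. Moreover, for every curve $\xi$ in $\mathfrak u(\mathcal H)$, equation (1) has a unique solution on $0\leq t\leq\tau$, this solution is a curve in $\mathcal S(\sigma)$, and it is a horizontal geodesic of $\mathcal S(\sigma)$ if and only if $\xi$ satisfies the Euler–Arnold equation $\dot\xi=\operatorname{ad}^*_\xi\xi$ on $0\leq t\leq\tau$ and $X_{\xi(0)}(\psi_0)$ is horizontal. -/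

import Mathlib

open Set MeasureTheory
open scoped ContDiff

namespace LabelGeodesics

/-- The spectrum `σ = (p₁, …, p_l; m₁, …, m_l)` of a density operator of finite rank: the different
positive eigenvalues in descending order, with their multiplicities. The trace is one. -/
structure Spectrum where
  /-- the number of different positive eigenvalues -/
  l : ℕ
  /-- the eigenvalues -/
  p : Fin l → ℝ
  /-- the multiplicities -/
  m : Fin l → ℕ
  p_pos : ∀ j, 0 < p j
  p_strictAnti : StrictAnti p
  m_pos : ∀ j, 0 < m j
  sum_eq_one : ∑ j, (m j : ℝ) * p j = 1

/-- The rank `k = m₁ + ⋯ + m_l` of the density operators with spectrum `σ`. -/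
def Spectrum.rank (σ : Spectrum) : ℕ := ∑ j, σ.m j

noncomputable section

variable {K : Type*} [NormedAddCommGroup K] [InnerProductSpace ℂ K]
variable {H : Type*} [NormedAddCommGroup H] [InnerProductSpace ℂ H]

/-- The projection `Π_j = ∑ |i⟩⟨i|`, where `i` runs through the `j`-th block of `m_j` consecutive
indices. (The index `i : Fin k` starts from `0`.) -/
def blockProj (σ : Spectrum) (e : OrthonormalBasis (Fin σ.rank) ℂ K) (j : Fin σ.l) : K →L[ℂ] K :=
  ∑ i ∈ (Finset.univ : Finset (Fin σ.rank)).filter (fun i : Fin σ.rank =>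
      ∑ a ∈ Finset.univ.filter (· < j), σ.m a ≤ (i : ℕ) ∧
        (i : ℕ) < ∑ a ∈ Finset.univ.filter (· ≤ j), σ.m a),
    InnerProductSpace.rankOne ℂ (e i) (e i)

/-- The spectral characteristic operator `P(σ) = ∑ p_j Π_j`, with respect to the computational
basis `e`. -/
def specOp (σ : Spectrum) (e : OrthonormalBasis (Fin σ.rank) ℂ K) : K →L[ℂ] K :=
  ∑ j, ((σ.p j : ℝ) : ℂ) • blockProj σ e j

variable [CompleteSpace K] [CompleteSpace H]

/-- `S(σ)`: the operators `ψ : K → H` such that `ψ† ψ = P(σ)`. -/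
def purifications (H : Type*) [NormedAddCommGroup H] [InnerProductSpace ℂ H] [CompleteSpace H]
    (σ : Spectrum) (e : OrthonormalBasis (Fin σ.rank) ℂ K) : Set (K →L[ℂ] H) :=
  {ψ | (ContinuousLinearMap.adjoint ψ).comp ψ = specOp σ e}

/-- The bundle projection `π(ψ) = ψ ψ†`. -/
def bundleProj (ψ : K →L[ℂ] H) : H →L[ℂ] H := ψ.comp (ContinuousLinearMap.adjoint ψ)

/-- The Riemannian metric `G(X, Y) = ½ Tr (X† Y + Y† X)`, the real part of the Hilbert–Schmidt
inner product. (The trace is real.) -/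
def hsMetric (X Y : K →L[ℂ] H) : ℝ :=
  (1 / 2) * (LinearMap.trace ℂ K
    (((ContinuousLinearMap.adjoint X).comp Y + (ContinuousLinearMap.adjoint Y).comp X :
      K →L[ℂ] K) : K →ₗ[ℂ] K)).re

/-- The tangent space at `ψ` of a submanifold `M` (without boundary) of a normed space: the
velocities at `ψ` of the smooth curves in `M` through `ψ`. -/
def tangentSpaceAt {E : Type*} [NormedAddCommGroup E] [NormedSpace ℝ E] (M : Set E) (ψ : E) :
    Set E :=
  {X | ∃ γ : ℝ → E, ContDiff ℝ ∞ γ ∧ (∀ s, γ s ∈ M) ∧ γ 0 = ψ ∧ deriv γ 0 = X}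

/-- The vertical space at `ψ`: the kernel of `dπ` on the tangent space of `S(σ)`. -/
def verticalSpace (σ : Spectrum) (e : OrthonormalBasis (Fin σ.rank) ℂ K) (ψ : K →L[ℂ] H) :
    Set (K →L[ℂ] H) :=
  {X | X ∈ tangentSpaceAt (purifications H σ e) ψ ∧
    fderiv ℝ (bundleProj : (K →L[ℂ] H) → (H →L[ℂ] H)) ψ X = 0}

/-- The horizontal space at `ψ`: the `G`-orthogonal complement of the vertical space in the tangent
space of `S(σ)`. -/
def horizontalSpace (σ : Spectrum) (e : OrthonormalBasis (Fin σ.rank) ℂ K) (ψ : K →L[ℂ] H) :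
    Set (K →L[ℂ] H) :=
  {X | X ∈ tangentSpaceAt (purifications H σ e) ψ ∧ ∀ Y ∈ verticalSpace σ e ψ, hsMetric X Y = 0}

/-- Smooth curves in `M` that are defined on the interval `0 ≤ t ≤ τ`. (The values of `γ` outside
the interval play no role.) -/
def IsCurveIn {E : Type*} [NormedAddCommGroup E] [NormedSpace ℝ E] (τ : ℝ) (M : Set E)
    (γ : ℝ → E) : Prop :=
  ContDiffOn ℝ ∞ γ (Icc 0 τ) ∧ ∀ t ∈ Icc (0 : ℝ) τ, γ t ∈ M

/-- The velocity field of a curve on `0 ≤ t ≤ τ` (one-sided at the end points). -/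
def velocity {E : Type*} [NormedAddCommGroup E] [NormedSpace ℝ E] (τ : ℝ) (γ : ℝ → E) : ℝ → E :=
  fun t => derivWithin γ (Icc 0 τ) t

/-- `W = ∇_t V`: the field `W` is the covariant derivative of the field `V` along the curve `γ` in
the submanifold `M` of the Euclidean space `(L(K, H), G)`, for the Levi-Civita connection of the
metric that `G` induces on `M`. That is, `W(t)` is the `G`-orthogonal projection on the tangent
space of `M` at `γ(t)` of the derivative of `V` in the ambient space. -/
def IsCovariantDeriv (τ : ℝ) (M : Set (K →L[ℂ] H)) (γ V W : ℝ → (K →L[ℂ] H)) : Prop :=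
  ∀ t ∈ Icc (0 : ℝ) τ, W t ∈ tangentSpaceAt M (γ t) ∧
    ∀ Y ∈ tangentSpaceAt M (γ t), hsMetric (velocity τ V t - W t) Y = 0

/-- Geodesics in `M`: smooth curves such that `∇_t γ̇ = 0`. -/
def IsGeodesic (τ : ℝ) (M : Set (K →L[ℂ] H)) (γ : ℝ → (K →L[ℂ] H)) : Prop :=
  IsCurveIn τ M γ ∧ IsCovariantDeriv τ M γ (velocity τ γ) (fun _ => 0)

/-- Horizontal geodesics in `S(σ)`. -/
def IsHorizontalGeodesic (τ : ℝ) (σ : Spectrum) (e : OrthonormalBasis (Fin σ.rank) ℂ K)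
    (ψ : ℝ → (K →L[ℂ] H)) : Prop :=
  IsGeodesic τ (purifications H σ e) ψ ∧
    ∀ t ∈ Icc (0 : ℝ) τ, velocity τ ψ t ∈ horizontalSpace σ e (ψ t)

/-- The Lie algebra `u(H)` of anti-Hermitian operators. -/
def lieU (H : Type*) [NormedAddCommGroup H] [InnerProductSpace ℂ H] [CompleteSpace H] :
    Set (H →L[ℂ] H) :=
  (skewAdjoint (H →L[ℂ] H) : Set (H →L[ℂ] H))

/-- The fundamental vector field `X_ξ(ψ) = d/ds [exp(sξ) ψ]_{s = 0}` of the left action of the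
unitary group of `H`. -/
def fundField (ξ : H →L[ℂ] H) (ψ : K →L[ℂ] H) : K →L[ℂ] H :=
  deriv (fun s : ℝ => (NormedSpace.exp (s • ξ)).comp ψ) 0

/-- The metric `ξ ∗ η = -½ Tr ((ξη + ηξ) ρ₀)` on `u(H)`. (The trace is real.) -/
def starMetric (ρ₀ ξ η : H →L[ℂ] H) : ℝ :=
  -(1 / 2) * (LinearMap.trace ℂ H (((ξ * η + η * ξ) * ρ₀ : H →L[ℂ] H) : H →ₗ[ℂ] H)).re

/-- `α = ad*_ξ ζ`: the element `α` of `u(H)` that satisfies `α ∗ η = ζ ∗ [ξ, η]` for all `η` in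
`u(H)`. (For a positive definite `ρ₀` there is precisely one such `α`.) -/
def IsAdStar (ρ₀ ξ ζ α : H →L[ℂ] H) : Prop :=
  α ∈ lieU H ∧ ∀ η ∈ lieU H, starMetric ρ₀ α η = starMetric ρ₀ ζ ⁅ξ, η⁆

/-- The Euler–Arnold equation `ξ̇ = ad*_ξ ξ` on `0 ≤ t ≤ τ`. -/
def EulerArnold (τ : ℝ) (ρ₀ : H →L[ℂ] H) (ξ : ℝ → (H →L[ℂ] H)) : Prop :=
  ∀ t ∈ Icc (0 : ℝ) τ, IsAdStar ρ₀ (ξ t) (ξ t) (velocity τ ξ t)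

/-- The terms of the Dyson series of the negative time-ordered exponential: the iterated integrals
of `ξ(t₁) ξ(t₂) ⋯ ξ(t_n)` over `0 ≤ t₁ ≤ t₂ ≤ ⋯ ≤ t_n ≤ t`. -/
def dysonNeg (ξ : ℝ → (H →L[ℂ] H)) : ℕ → ℝ → (H →L[ℂ] H)
  | 0 => fun _ => 1
  | n + 1 => fun t => ∫ s in (0 : ℝ)..t, dysonNeg ξ n s * ξ s

/-- The terms of the Dyson series of the positive time-ordered exponential: the iterated integrals
of `ξ(t_n) ⋯ ξ(t₂) ξ(t₁)` over `0 ≤ t₁ ≤ t₂ ≤ ⋯ ≤ t_n ≤ t`. -/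
def dysonPos (ξ : ℝ → (H →L[ℂ] H)) : ℕ → ℝ → (H →L[ℂ] H)
  | 0 => fun _ => 1
  | n + 1 => fun t => ∫ s in (0 : ℝ)..t, ξ s * dysonPos ξ n s

/-- The negative time-ordered exponential `exp₋ (∫₀ᵗ ξ)` (later times to the right). -/
def expNeg (ξ : ℝ → (H →L[ℂ] H)) (t : ℝ) : H →L[ℂ] H := ∑' n, dysonNeg ξ n t

/-- The positive time-ordered exponential `exp₊ (∫₀ᵗ ξ)` (later times to the left). -/
def expPos (ξ : ℝ → (H →L[ℂ] H)) (t : ℝ) : H →L[ℂ] H := ∑' n, dysonPos ξ n t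

/-- The Hamiltonian `H_ξ(t) = iℏ exp₋ (∫₀ᵗ ξ) ξ(t) exp₊ (-∫₀ᵗ ξ)`. -/
def hamiltonian (ℏ : ℝ) (ξ : ℝ → (H →L[ℂ] H)) (t : ℝ) : H →L[ℂ] H :=
  (Complex.I * (ℏ : ℂ)) • (expNeg ξ t * ξ t * expPos (fun s => -ξ s) t)

/-- `ψ` solves, on `0 ≤ t ≤ τ`, the initial value problem `iℏ ψ̇ = A ψ`, `ψ(0) = ψ₀` for the
Schrödinger equation of the (time-dependent) Hamiltonian `A`. -/
def SolvesSchrodinger (ℏ τ : ℝ) (A : ℝ → (H →L[ℂ] H)) (ψ₀ : K →L[ℂ] H)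
    (ψ : ℝ → (K →L[ℂ] H)) : Prop :=
  DifferentiableOn ℝ ψ (Icc 0 τ) ∧
    (∀ t ∈ Icc (0 : ℝ) τ, (Complex.I * (ℏ : ℂ)) • velocity τ ψ t = (A t).comp (ψ t)) ∧
    ψ 0 = ψ₀

end

end LabelGeodesics

open LabelGeodesics

/-! The factor `U = expNeg ξ` solves `U' = U ξ`, `U 0 = 1`, and is unitary because `ξ` is
skew-adjoint. As `expPos (-ξ)` is its adjoint, the Hamiltonian is `iℏ U ξ U†` and the solutions are
exactly `ψ = U ψ₀` (`solvesSchrodinger_iff`). Conversely, `ψ₀` is invertible, so a curve `ψ` in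
`S(σ)` gives a unitary curve `W = ψ ψ₀⁻¹`, and `ξ = W† W'` generates it (`exists_generator`).

Left translation then moves everything to `u(H)`. Tangent vectors at `U ψ₀` are the `U η ψ₀`, on
which `G` is the metric `∗`. The acceleration of `ψ` is `U (ξ² + ξ') ψ₀`, and its product with `U η
ψ₀` is `ξ' ∗ η - ξ ∗ [ξ, η]` (`hsMetric_comp_acceleration`), so geodesics correspond to the
Euler–Arnold equation. Vertical vectors are those with `η` commuting with `ρ₀`; for such `η` the
quantity `ξ ∗ η` is conserved (`starMetric_eq_of_eulerArnold`), so horizontality at time `0`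
persists. -/

namespace LabelGeodesics

/-! ### Dyson series: convergence, differential equation, adjoint. -/

section TimeOrderedExponential

variable {H : Type*} [NormedAddCommGroup H] [InnerProductSpace ℂ H]

theorem dysonNeg_congr {τ : ℝ} {ξ ζ : ℝ → (H →L[ℂ] H)} (h : EqOn ξ ζ (Icc 0 τ)) (n : ℕ) :
    EqOn (dysonNeg ξ n) (dysonNeg ζ n) (Icc 0 τ) := by
  induction n with
  | zero => intro t _; rfl
  | succ n ih =>
    intro t ht
    refine intervalIntegral.integral_congr fun s hs => ?_
    rw [uIcc_of_le ht.1] at hs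
    have hs' : s ∈ Icc 0 τ := ⟨hs.1, hs.2.trans ht.2⟩
    simp only [ih hs', h hs']

theorem expNeg_congr {τ : ℝ} {ξ ζ : ℝ → (H →L[ℂ] H)} (h : EqOn ξ ζ (Icc 0 τ)) :
    EqOn (expNeg ξ) (expNeg ζ) (Icc 0 τ) := fun _ ht =>
  tsum_congr fun n => dysonNeg_congr h n ht

theorem expNeg_zero (ξ : ℝ → (H →L[ℂ] H)) : expNeg ξ 0 = 1 := by
  rw [expNeg, tsum_eq_single 0]
  · rfl
  · intro n hn
    obtain ⟨m, rfl⟩ := Nat.exists_eq_succ_of_ne_zero hn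
    exact intervalIntegral.integral_same

variable [CompleteSpace H]

theorem continuous_dysonNeg {ξ : ℝ → (H →L[ℂ] H)} (hξ : Continuous ξ) (n : ℕ) :
    Continuous (dysonNeg ξ n) := by
  induction n with
  | zero => exact continuous_const
  | succ n ih =>
    exact intervalIntegral.continuous_primitive
      (fun a b => (ih.mul hξ).intervalIntegrable a b) 0

theorem hasDerivAt_dysonNeg_succ {ξ : ℝ → (H →L[ℂ] H)} (hξ : Continuous ξ) (n : ℕ) (t : ℝ) :
    HasDerivAt (dysonNeg ξ (n + 1)) (dysonNeg ξ n t * ξ t) t :=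
  intervalIntegral.integral_hasDerivAt_right
    (((continuous_dysonNeg hξ n).mul hξ).intervalIntegrable _ _)
    (((continuous_dysonNeg hξ n).mul hξ).stronglyMeasurableAtFilter _ _)
    ((continuous_dysonNeg hξ n).mul hξ).continuousAt

/-- The factorial is the volume of the ordered simplex, obtained one integration at a time. It makes
the Dyson series converge like an exponential series. -/
theorem norm_dysonNeg_le {ξ : ℝ → (H →L[ℂ] H)} {M : ℝ} (hM : ∀ t, ‖ξ t‖ ≤ M) (n : ℕ) (t : ℝ) :
    ‖dysonNeg ξ n t‖ ≤ (M * |t|) ^ n / n.factorial := by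
  have hM0 : 0 ≤ M := (norm_nonneg _).trans (hM 0)
  induction n generalizing t with
  | zero => 
    rw [pow_zero, Nat.factorial_zero, Nat.cast_one, div_one]
    exact ContinuousLinearMap.norm_id_le
  | succ n ih =>
    have hint : IntegrableOn (fun s : ℝ => M ^ (n + 1) / n.factorial * |s - 0| ^ n)
        (Set.uIoc 0 t) :=
      (Continuous.intervalIntegrable (by fun_prop) 0 t).def'
    calc ‖dysonNeg ξ (n + 1) t‖
        = ‖∫ s in Set.uIoc 0 t, dysonNeg ξ n s * ξ s‖ :=
          intervalIntegral.norm_intervalIntegral_eq _ _ _ _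
      _ ≤ ∫ s in Set.uIoc 0 t, M ^ (n + 1) / n.factorial * |s - 0| ^ n := by
          refine norm_integral_le_of_norm_le hint (Filter.Eventually.of_forall fun s => ?_)
          calc ‖dysonNeg ξ n s * ξ s‖ ≤ ‖dysonNeg ξ n s‖ * ‖ξ s‖ := norm_mul_le _ _
            _ ≤ (M * |s|) ^ n / n.factorial * M :=
              mul_le_mul (ih s) (hM s) (norm_nonneg _) (by positivity)
            _ = M ^ (n + 1) / n.factorial * |s - 0| ^ n := by rw [sub_zero]; ring
      _ = (M * |t|) ^ (n + 1) / (n + 1).factorial := by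
          rw [integral_const_mul, integral_pow_abs_sub_uIoc, Nat.factorial_succ, sub_zero]
          push_cast
          field_simp
          ring

theorem hasDerivAt_tsum_of_hasDerivAt_succ {ξ : ℝ → (H →L[ℂ] H)} {F : ℕ → ℝ → (H →L[ℂ] H)}
    {M : ℝ} (hM : ∀ t, ‖ξ t‖ ≤ M) (h0 : ∀ t, F 0 t = 1)
    (hF : ∀ n t, HasDerivAt (F (n + 1)) (F n t * ξ t) t)
    (hb : ∀ n t, ‖F n t‖ ≤ (M * |t|) ^ n / n.factorial) (t : ℝ) :
    HasDerivAt (fun s => ∑' n, F n s) ((∑' n, F n t) * ξ t) t := by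
  have hM0 : 0 ≤ M := (norm_nonneg _).trans (hM 0)
  set R : ℝ := |t| + 1
  have htR : t ∈ Ioo (-R) R := abs_lt.1 (lt_add_one _)
  have hsum : ∀ s, Summable fun n => F n s := fun s =>
    Summable.of_norm_bounded (Real.summable_pow_div_factorial (M * |s|)) fun n => hb n s
  -- The zeroth term is constant, so only the shifted series is differentiated. On the bounded
  -- interval the derivatives have a summable bound independent of `s`.
  have key := hasDerivAt_tsum_of_isPreconnected (g := fun n => F (n + 1))
    (g' := fun n s => F n s * ξ s)
    ((Real.summable_pow_div_factorial (M * R)).mul_right M)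
    (isOpen_Ioo (a := -R) (b := R)) isPreconnected_Ioo
    (fun n s _ => hF n s)
    (fun n s hs => by
      have hsR : |s| ≤ R := (abs_lt.2 hs).le
      calc ‖F n s * ξ s‖ ≤ ‖F n s‖ * ‖ξ s‖ := norm_mul_le _ _
        _ ≤ (M * |s|) ^ n / n.factorial * M :=
          mul_le_mul (hb n s) (hM s) (norm_nonneg _) (by positivity)
        _ ≤ (M * R) ^ n / n.factorial * M := by gcongr)
    htR ((summable_nat_add_iff 1).2 (hsum t)) htR
  rw [(hsum t).tsum_mul_right (ξ t)] at key
  refine (key.const_add 1).congr_of_eventuallyEq (Filter.Eventually.of_forall fun s => ?_)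
  simp only [(hsum s).tsum_eq_zero_add, h0]

theorem hasDerivAt_expNeg {ξ : ℝ → (H →L[ℂ] H)} (hξ : Continuous ξ) {M : ℝ}
    (hM : ∀ t, ‖ξ t‖ ≤ M) (t : ℝ) : HasDerivAt (expNeg ξ) (expNeg ξ t * ξ t) t :=
  hasDerivAt_tsum_of_hasDerivAt_succ hM (fun _ => rfl) (hasDerivAt_dysonNeg_succ hξ)
    (norm_dysonNeg_le hM) t

/-- On `[0, τ]` the Dyson terms see only values of `ξ` on `[0, τ]`, so `ξ` may be replaced by its
constant extension, which is continuous and bounded on the whole line. -/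
theorem hasDerivWithinAt_expNeg {τ : ℝ} (hτ : 0 ≤ τ) {ξ : ℝ → (H →L[ℂ] H)}
    (hξ : ContinuousOn ξ (Icc 0 τ)) {t : ℝ} (ht : t ∈ Icc 0 τ) :
    HasDerivWithinAt (expNeg ξ) (expNeg ξ t * ξ t) (Icc 0 τ) t := by
  set ζ : ℝ → (H →L[ℂ] H) := IccExtend hτ ((Icc 0 τ).domRestrict ξ)
  have hζ : Continuous ζ := (continuousOn_iff_continuous_domRestrict.1 hξ).Icc_extend'
  have heq : EqOn ξ ζ (Icc 0 τ) := fun s hs =>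
    (IccExtend_of_mem hτ ((Icc 0 τ).domRestrict ξ) hs).symm
  obtain ⟨M, hM⟩ := isCompact_Icc.exists_bound_of_continuousOn hξ
  have hM' : ∀ s, ‖ζ s‖ ≤ M := fun s => hM _ (projIcc 0 τ hτ s).2
  have h := (hasDerivAt_expNeg hζ hM' t).hasDerivWithinAt (s := Icc 0 τ)
  rw [← expNeg_congr heq ht, ← heq ht] at h
  exact h.congr (expNeg_congr heq) (expNeg_congr heq ht)

/-- The adjoint reverses the order of the factors and turns each `ξ` into `-ξ`. -/
theorem star_dysonNeg {τ : ℝ} {ξ : ℝ → (H →L[ℂ] H)} (hξ : ∀ t ∈ Icc 0 τ, ξ t ∈ lieU H)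
    (n : ℕ) {t : ℝ} (ht : t ∈ Icc 0 τ) :
    star (dysonNeg ξ n t) = dysonPos (fun s => -ξ s) n t := by
  induction n generalizing t with
  | zero => exact star_one _
  | succ n ih =>
    have h := LinearIsometry.intervalIntegral_comp_comm
      (starₗᵢ ℝ : (H →L[ℂ] H) ≃ₗᵢ⋆[ℝ] (H →L[ℂ] H)).toLinearIsometry
      (μ := volume) (a := 0) (b := t) (fun s => dysonNeg ξ n s * ξ s)
    refine h.symm.trans (intervalIntegral.integral_congr fun s hs => ?_)
    rw [uIcc_of_le ht.1] at hs
    have hs' : s ∈ Icc 0 τ := ⟨hs.1, hs.2.trans ht.2⟩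
    change star (dysonNeg ξ n s * ξ s) = -ξ s * dysonPos (fun s => -ξ s) n s
    rw [star_mul, ih hs', skewAdjoint.mem_iff.1 (hξ s hs')]

theorem star_expNeg {τ : ℝ} {ξ : ℝ → (H →L[ℂ] H)} (hξ : ∀ t ∈ Icc 0 τ, ξ t ∈ lieU H)
    {t : ℝ} (ht : t ∈ Icc 0 τ) :
    expPos (fun s => -ξ s) t = star (expNeg ξ t) := by
  rw [expNeg, tsum_star]
  exact tsum_congr fun n => (star_dysonNeg hξ n ht).symm

end TimeOrderedExponential

/-! ### Product rule and smoothness for composition. -/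

section Calculus

variable {E F G : Type*} [NormedAddCommGroup E] [NormedSpace ℂ E] [NormedAddCommGroup F]
  [NormedSpace ℂ F] [NormedAddCommGroup G] [NormedSpace ℂ G]

/-- Composition of complex linear maps as a real bilinear map. -/
noncomputable def compBilin (E F G : Type*) [NormedAddCommGroup E] [NormedSpace ℂ E]
    [NormedAddCommGroup F] [NormedSpace ℂ F] [NormedAddCommGroup G] [NormedSpace ℂ G] :
    (F →L[ℂ] G) →L[ℝ] (E →L[ℂ] F) →L[ℝ] (E →L[ℂ] G) :=
  (ContinuousLinearMap.compL ℂ E F G).bilinearRestrictScalars ℝ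

theorem hasDerivWithinAt_comp_clm {u : ℝ → (F →L[ℂ] G)} {v : ℝ → (E →L[ℂ] F)} {u' v'}
    {s : Set ℝ} {t : ℝ} (hu : HasDerivWithinAt u u' s t) (hv : HasDerivWithinAt v v' s t) :
    HasDerivWithinAt (fun x => (u x).comp (v x)) ((u t).comp v' + u'.comp (v t)) s t :=
  (compBilin E F G).hasDerivWithinAt_of_bilinear hu hv

theorem contDiffOn_comp_clm {u : ℝ → (F →L[ℂ] G)} {v : ℝ → (E →L[ℂ] F)} {s : Set ℝ}
    {n : WithTop ℕ∞} (hu : ContDiffOn ℝ n u s) (hv : ContDiffOn ℝ n v s) :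
    ContDiffOn ℝ n (fun x => (u x).comp (v x)) s :=
  (compBilin E F G).isBoundedBilinearMap.contDiff.comp_contDiffOn (hu.prodMk hv)

end Calculus

/-! ### Real differentiability of the adjoint, and the derivatives built on it. -/

section Adjoint

variable {K : Type*} [NormedAddCommGroup K] [InnerProductSpace ℂ K] [CompleteSpace K]
variable {H : Type*} [NormedAddCommGroup H] [InnerProductSpace ℂ H] [CompleteSpace H]

/-- The adjoint as a real linear map. -/
noncomputable def adjointReal (K H : Type*) [NormedAddCommGroup K] [InnerProductSpace ℂ K]
    [CompleteSpace K] [NormedAddCommGroup H] [InnerProductSpace ℂ H] [CompleteSpace H] :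
    (K →L[ℂ] H) →L[ℝ] (H →L[ℂ] K) where
  toFun A := ContinuousLinearMap.adjoint A
  map_add' := map_add _
  map_smul' r A := by
    rw [RCLike.real_smul_eq_coe_smul (K := ℂ) r A, map_smulₛₗ, RCLike.conj_ofReal,
      ← RCLike.real_smul_eq_coe_smul (K := ℂ)]
    rfl
  cont := ContinuousLinearMap.adjoint.continuous

theorem hasDerivWithinAt_adjoint_clm {u : ℝ → (K →L[ℂ] H)} {u' : K →L[ℂ] H} {s : Set ℝ} {t : ℝ}
    (hu : HasDerivWithinAt u u' s t) :
    HasDerivWithinAt (fun x => ContinuousLinearMap.adjoint (u x))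
      (ContinuousLinearMap.adjoint u') s t :=
  (adjointReal K H).hasFDerivAt.comp_hasDerivWithinAt t hu

theorem contDiffOn_adjoint_clm {u : ℝ → (K →L[ℂ] H)} {s : Set ℝ} {n : WithTop ℕ∞}
    (hu : ContDiffOn ℝ n u s) :
    ContDiffOn ℝ n (fun x => ContinuousLinearMap.adjoint (u x)) s :=
  (adjointReal K H).contDiff.comp_contDiffOn hu

theorem fderiv_bundleProj (ψ X : K →L[ℂ] H) :
    fderiv ℝ (bundleProj : (K →L[ℂ] H) → (H →L[ℂ] H)) ψ X =
      ψ.comp (ContinuousLinearMap.adjoint X) + X.comp (ContinuousLinearMap.adjoint ψ) := by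
  have h := (compBilin H K H).hasFDerivAt_of_bilinear (hasFDerivAt_id (𝕜 := ℝ) ψ)
    ((adjointReal K H).hasFDerivAt (x := ψ))
  have h' : HasFDerivAt (bundleProj : (K →L[ℂ] H) → (H →L[ℂ] H)) _ ψ := h
  rw [h'.fderiv]
  rfl

theorem eq_of_derivWithin_eq_zero {E : Type*} [NormedAddCommGroup E] [NormedSpace ℝ E] {τ : ℝ}
    {f : ℝ → E} (hτ : 0 < τ) (hf : ∀ t ∈ Icc 0 τ, HasDerivWithinAt f 0 (Icc 0 τ) t) {t : ℝ}
    (ht : t ∈ Icc 0 τ) : f t = f 0 :=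
  constant_of_derivWithin_zero (fun s hs => (hf s hs).differentiableWithinAt)
    (fun s hs => (hf s ⟨hs.1, hs.2.le⟩).derivWithin
      (uniqueDiffOn_Icc hτ s ⟨hs.1, hs.2.le⟩)) t ht

theorem fundField_eq {K : Type*} [NormedAddCommGroup K] [InnerProductSpace ℂ K]
    (ξ : H →L[ℂ] H) (ψ : K →L[ℂ] H) : fundField ξ ψ = ξ.comp ψ := by
  have h := (hasDerivAt_exp_smul_const (𝕂 := ℝ) ξ (0 : ℝ)).hasDerivWithinAt (s := univ)
  have h' := (hasDerivWithinAt_comp_clm h (hasDerivWithinAt_const 0 univ ψ)).hasDerivAt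
    Filter.univ_mem
  rw [fundField, h'.deriv]
  ext x
  simp

end Adjoint

/-! ### Unitarity of the propagator and the Schrödinger equation. -/

section Propagator

variable {K : Type*} [NormedAddCommGroup K] [InnerProductSpace ℂ K]
variable {H : Type*} [NormedAddCommGroup H] [InnerProductSpace ℂ H] [CompleteSpace H]
variable {τ : ℝ} {ξ : ℝ → (H →L[ℂ] H)}

/-- Bootstrap: in `U' = U ξ` the right side is as smooth as `U`, so `U` gains one derivative each
time. -/
theorem contDiffOn_expNeg (hτ : 0 < τ) (hξ : ContDiffOn ℝ ∞ ξ (Icc 0 τ)) :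
    ContDiffOn ℝ ∞ (expNeg ξ) (Icc 0 τ) := by
  have hd := fun t (ht : t ∈ Icc 0 τ) => hasDerivWithinAt_expNeg hτ.le hξ.continuousOn ht
  rw [contDiffOn_infty]
  intro n
  induction n with
  | zero => exact contDiffOn_zero.2 fun t ht => (hd t ht).continuousWithinAt
  | succ n ih =>
    push_cast
    rw [contDiffOn_succ_iff_derivWithin (uniqueDiffOn_Icc hτ)]
    refine ⟨fun t ht => (hd t ht).differentiableWithinAt, by simp, ?_⟩
    refine (contDiffOn_comp_clm ih (hξ.of_le (by exact_mod_cast le_top))).congr fun t ht => ?_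
    exact (hd t ht).derivWithin (uniqueDiffOn_Icc hτ t ht)

/-- Two solutions of `W' = W ξ`, for `ξ` skew-adjoint, keep the product of one with the adjoint of
the other. -/
theorem mul_star_eq_of_hasDerivWithinAt (hτ : 0 < τ) (hs : ∀ t ∈ Icc 0 τ, ξ t ∈ lieU H)
    {V W : ℝ → (H →L[ℂ] H)}
    (hV : ∀ t ∈ Icc 0 τ, HasDerivWithinAt V (V t * ξ t) (Icc 0 τ) t)
    (hW : ∀ t ∈ Icc 0 τ, HasDerivWithinAt W (W t * ξ t) (Icc 0 τ) t) {t : ℝ}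
    (ht : t ∈ Icc 0 τ) : W t * star (V t) = W 0 * star (V 0) := by
  refine eq_of_derivWithin_eq_zero (f := fun t => W t * star (V t)) hτ (fun t ht => ?_) ht
  have h := hasDerivWithinAt_comp_clm (hW t ht) (hasDerivWithinAt_adjoint_clm (hV t ht))
  refine h.congr_deriv ?_
  change W t * star (V t * ξ t) + (W t * ξ t) * star (V t) = 0
  rw [star_mul, skewAdjoint.mem_iff.1 (hs t ht)]
  noncomm_ring

theorem expNeg_mul_star (hτ : 0 < τ) (hξ : IsCurveIn τ (lieU H) ξ) {t : ℝ} (ht : t ∈ Icc 0 τ) :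
    expNeg ξ t * star (expNeg ξ t) = 1 := by
  have hd := fun t (ht : t ∈ Icc 0 τ) => hasDerivWithinAt_expNeg hτ.le hξ.1.continuousOn ht
  rw [mul_star_eq_of_hasDerivWithinAt hτ hξ.2 hd hd ht, expNeg_zero, star_one, one_mul]

theorem star_mul_expNeg [FiniteDimensional ℂ H] (hτ : 0 < τ) (hξ : IsCurveIn τ (lieU H) ξ)
    {t : ℝ} (ht : t ∈ Icc 0 τ) : star (expNeg ξ t) * expNeg ξ t = 1 := by
  have h := congrArg (ContinuousLinearMap.toLinearMap) (expNeg_mul_star hτ hξ ht)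
  have h' := mul_eq_one_comm.1 h
  exact ContinuousLinearMap.coe_injective h'

theorem eq_expNeg_of_hasDerivWithinAt [FiniteDimensional ℂ H] (hτ : 0 < τ)
    (hξ : IsCurveIn τ (lieU H) ξ) {W : ℝ → (H →L[ℂ] H)}
    (hW : ∀ t ∈ Icc 0 τ, HasDerivWithinAt W (W t * ξ t) (Icc 0 τ) t) (hW0 : W 0 = 1) {t : ℝ}
    (ht : t ∈ Icc 0 τ) : W t = expNeg ξ t := by
  have hd := fun t (ht : t ∈ Icc 0 τ) => hasDerivWithinAt_expNeg hτ.le hξ.1.continuousOn ht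
  have h := mul_star_eq_of_hasDerivWithinAt hτ hξ.2 hd hW ht
  rw [expNeg_zero, hW0, star_one, one_mul] at h
  calc W t = W t * (star (expNeg ξ t) * expNeg ξ t) := by rw [star_mul_expNeg hτ hξ ht, mul_one]
    _ = expNeg ξ t := by rw [← mul_assoc, h, one_mul]

theorem hasDerivWithinAt_expNeg_comp (hτ : 0 < τ) (hξ : IsCurveIn τ (lieU H) ξ)
    (ψ₀ : K →L[ℂ] H) {t : ℝ} (ht : t ∈ Icc 0 τ) :
    HasDerivWithinAt (fun t => (expNeg ξ t).comp ψ₀) ((expNeg ξ t * ξ t).comp ψ₀) (Icc 0 τ) t := by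
  have h := hasDerivWithinAt_comp_clm (hasDerivWithinAt_expNeg hτ.le hξ.1.continuousOn ht)
    (hasDerivWithinAt_const t (Icc 0 τ) ψ₀)
  simpa using h

theorem solvesSchrodinger_iff [FiniteDimensional ℂ H] {ℏ : ℝ} (hℏ : 0 < ℏ) (hτ : 0 < τ)
    (hξ : IsCurveIn τ (lieU H) ξ) (ψ₀ : K →L[ℂ] H) (ψ : ℝ → (K →L[ℂ] H)) :
    SolvesSchrodinger ℏ τ (hamiltonian ℏ ξ) ψ₀ ψ ↔
      EqOn ψ (fun t => (expNeg ξ t).comp ψ₀) (Icc 0 τ) := by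
  have h0 : (0 : ℝ) ∈ Icc 0 τ := ⟨le_rfl, hτ.le⟩
  have hne : Complex.I * (ℏ : ℂ) ≠ 0 :=
    mul_ne_zero Complex.I_ne_zero (Complex.ofReal_ne_zero.2 hℏ.ne')
  have hH : ∀ t ∈ Icc 0 τ, hamiltonian ℏ ξ t =
      (Complex.I * (ℏ : ℂ)) • (expNeg ξ t * ξ t * star (expNeg ξ t)) := fun t ht => by
    rw [hamiltonian, star_expNeg hξ.2 ht]
  constructor
  · rintro ⟨hd, heq, hi⟩ t ht
    have hderiv : ∀ t ∈ Icc 0 τ, HasDerivWithinAt ψ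
        ((expNeg ξ t * ξ t * star (expNeg ξ t)).comp (ψ t)) (Icc 0 τ) t := fun t ht => by
      have h := heq t ht
      rw [hH t ht, ContinuousLinearMap.smul_comp] at h
      rw [← smul_right_injective _ hne h]
      exact (hd t ht).hasDerivWithinAt
    -- In the rotating frame the Schrödinger equation becomes trivial: `U† ψ` is constant, which
    -- gives uniqueness.
    have hconst := eq_of_derivWithin_eq_zero (f := fun t => (star (expNeg ξ t)).comp (ψ t)) hτ
      (fun t ht => by
        have h := hasDerivWithinAt_comp_clm (hasDerivWithinAt_adjoint_clm
          (hasDerivWithinAt_expNeg hτ.le hξ.1.continuousOn ht)) (hderiv t ht)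
        refine h.congr_deriv ?_
        change (star (expNeg ξ t) * (expNeg ξ t * ξ t * star (expNeg ξ t))).comp (ψ t) +
          (star (expNeg ξ t * ξ t)).comp (ψ t) = 0
        rw [star_mul, skewAdjoint.mem_iff.1 (hξ.2 t ht), mul_assoc, ← mul_assoc,
          star_mul_expNeg hτ hξ ht, one_mul, ← ContinuousLinearMap.add_comp, neg_mul,
          add_neg_cancel, ContinuousLinearMap.zero_comp]) ht
    simp only [expNeg_zero, star_one, hi] at hconst
    change ψ t = (expNeg ξ t).comp ψ₀
    calc ψ t = (expNeg ξ t * star (expNeg ξ t)).comp (ψ t) := by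
          rw [expNeg_mul_star hτ hξ ht]; rfl
      _ = (expNeg ξ t).comp ((star (expNeg ξ t)).comp (ψ t)) := rfl
      _ = (expNeg ξ t).comp ψ₀ := by rw [hconst]; rfl
  · intro h
    have hderiv : ∀ t ∈ Icc 0 τ, HasDerivWithinAt ψ ((expNeg ξ t * ξ t).comp ψ₀) (Icc 0 τ) t :=
      fun t ht => (hasDerivWithinAt_expNeg_comp hτ hξ ψ₀ ht).congr h (h ht)
    refine ⟨fun t ht => (hderiv t ht).differentiableWithinAt, fun t ht => ?_, ?_⟩
    · rw [hH t ht, ContinuousLinearMap.smul_comp, h ht, velocity,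
        (hderiv t ht).derivWithin (uniqueDiffOn_Icc hτ t ht)]
      congr 1
      change _ = (expNeg ξ t * ξ t * star (expNeg ξ t) * expNeg ξ t).comp ψ₀
      rw [mul_assoc _ (star _), star_mul_expNeg hτ hξ ht, mul_one]
    · rw [h h0]
      simp only [expNeg_zero]
      rfl

end Propagator

/-! ### Invertibility of `ψ₀`; tangent and vertical spaces. -/

section Geometry

variable {K : Type*} [NormedAddCommGroup K] [InnerProductSpace ℂ K]
variable {H : Type*} [NormedAddCommGroup H] [InnerProductSpace ℂ H]

theorem Spectrum.exists_block (σ : Spectrum) (i : Fin σ.rank) :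
    ∃ j : Fin σ.l, ∑ a ∈ Finset.univ.filter (· < j), σ.m a ≤ (i : ℕ) ∧
      (i : ℕ) < ∑ a ∈ Finset.univ.filter (· ≤ j), σ.m a := by
  let s : Finset (Fin σ.l) :=
    Finset.univ.filter fun j => (i : ℕ) < ∑ a ∈ Finset.univ.filter (· ≤ j), σ.m a
  have hl : 0 < σ.l := by
    rcases Nat.eq_zero_or_pos σ.l with h | h
    · have : IsEmpty (Fin σ.l) := by rw [h]; infer_instance
      have hi := i.2
      simp [Spectrum.rank] at hi
    · exact h
  have hs : s.Nonempty := by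
    refine ⟨⟨σ.l - 1, by omega⟩, Finset.mem_filter.2 ⟨Finset.mem_univ _, ?_⟩⟩
    rw [Finset.filter_true_of_mem fun a _ => Fin.le_def.2 (by have := a.2; simp only; omega)]
    exact i.2
  -- The block is the first one whose cumulative multiplicity exceeds `i`; minimality gives the
  -- lower bound.
  refine ⟨s.min' hs, ?_, (Finset.mem_filter.1 (s.min'_mem hs)).2⟩
  set j := s.min' hs with hj
  by_cases h0 : (j : ℕ) = 0
  · rw [Finset.filter_false_of_mem fun a _ => by rw [Fin.lt_def]; omega]
    simp
  · let j' : Fin σ.l := ⟨j - 1, by have := j.2; omega⟩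
    have hlt : j' < j := Fin.lt_def.2 (by simp only [j']; omega)
    have hnot : j' ∉ s := fun hmem => absurd (s.min'_le _ hmem) (not_le.2 hlt)
    have hle : ∑ a ∈ Finset.univ.filter (· ≤ j'), σ.m a ≤ (i : ℕ) := by
      simpa [s] using hnot
    convert hle using 3 with a
    rw [Fin.lt_def, Fin.le_def]
    simp only [j']
    omega

/-- `P(σ)` is diagonal in the basis `e`. The eigenvalue is written as a sum over all blocks
containing `i`, so disjointness of the blocks is not needed for positivity. -/
theorem inner_specOp (σ : Spectrum) (e : OrthonormalBasis (Fin σ.rank) ℂ K) (i : Fin σ.rank) :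
    ∃ c : ℝ, 0 < c ∧ ∀ x, inner ℂ (e i) (specOp σ e x) = c * inner ℂ (e i) x := by
  classical
  let b : Fin σ.l → Prop := fun j => ∑ a ∈ Finset.univ.filter (· < j), σ.m a ≤ (i : ℕ) ∧
      (i : ℕ) < ∑ a ∈ Finset.univ.filter (· ≤ j), σ.m a
  refine ⟨∑ j, if b j then σ.p j else 0, ?_, fun x => ?_⟩
  · obtain ⟨j, hj⟩ := σ.exists_block i
    refine Finset.sum_pos' (fun j _ => ?_) ⟨j, Finset.mem_univ _, ?_⟩
    · split_ifs
      exacts [(σ.p_pos j).le, le_rfl]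
    · rw [if_pos hj]
      exact σ.p_pos j
  · have hb : ∀ j, inner ℂ (e i) (blockProj σ e j x) = if b j then inner ℂ (e i) x else 0 := by
      intro j
      simp only [blockProj, sum_apply, InnerProductSpace.rankOne_apply,
        inner_sum, inner_smul_right, e.inner_eq_ite, mul_ite, mul_one, mul_zero]
      rw [Finset.sum_ite_eq]
      simp [b]
    simp only [specOp, sum_apply, smul_apply, inner_sum,
      inner_smul_right, hb, Complex.ofReal_sum, Finset.sum_mul]
    refine Finset.sum_congr rfl fun j _ => ?_
    split_ifs <;> simp

theorem specOp_injective (σ : Spectrum) (e : OrthonormalBasis (Fin σ.rank) ℂ K) :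
    Function.Injective (specOp σ e) := by
  rw [injective_iff_map_eq_zero]
  intro x hx
  refine InnerProductSpace.ext_inner_left_basis e.toBasis fun i => ?_
  obtain ⟨c, hc, h⟩ := inner_specOp σ e i
  have hi := h x
  rw [hx, inner_zero_right, eq_comm, mul_eq_zero] at hi
  rw [OrthonormalBasis.coe_toBasis, inner_zero_right]
  exact hi.resolve_left (Complex.ofReal_ne_zero.2 hc.ne')

variable [CompleteSpace K] [CompleteSpace H]
variable {σ : Spectrum} {e : OrthonormalBasis (Fin σ.rank) ℂ K} {ψ₀ : K →L[ℂ] H}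

/-- Invertibility of `ψ₀ ψ₀†` gives a right inverse of `ψ₀`; injectivity of `ψ₀† ψ₀ = P(σ)` makes it
two-sided. -/
theorem exists_inverse_of_isUnit_bundleProj (hψ₀ : ψ₀ ∈ purifications H σ e)
    (hinv : IsUnit (bundleProj ψ₀)) :
    ∃ χ : H →L[ℂ] K, χ.comp ψ₀ = ContinuousLinearMap.id ℂ K ∧
      ψ₀.comp χ = ContinuousLinearMap.id ℂ H := by
  have hinj : Function.Injective ψ₀ := by
    refine Function.Injective.of_comp (f := ContinuousLinearMap.adjoint ψ₀) ?_
    have h := specOp_injective σ e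
    rw [← (hψ₀ : _ = _)] at h
    exact h
  obtain ⟨R, hR⟩ := hinv.exists_right_inv
  refine ⟨(ContinuousLinearMap.adjoint ψ₀).comp R, ?_, hR⟩
  ext x
  apply hinj
  exact congrArg (fun A : H →L[ℂ] H => A (ψ₀ x)) hR

theorem comp_mem_purifications {U : H →L[ℂ] H} (hU : star U * U = 1)
    (hψ₀ : ψ₀ ∈ purifications H σ e) : U.comp ψ₀ ∈ purifications H σ e := by
  change (ContinuousLinearMap.adjoint (U.comp ψ₀)).comp (U.comp ψ₀) = specOp σ e
  rw [ContinuousLinearMap.adjoint_comp]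
  change (ContinuousLinearMap.adjoint ψ₀).comp ((star U * U).comp ψ₀) = specOp σ e
  rw [hU]
  exact hψ₀

/-- The tangent vectors of `S(σ)` at an invertible `U ψ₀` are the `U η ψ₀`, `η ∈ u(H)`. -/
theorem mem_tangentSpaceAt_purifications {U : H →L[ℂ] H} (hU : star U * U = 1)
    (hU' : U * star U = 1) (hψ₀ : ψ₀ ∈ purifications H σ e) {χ : H →L[ℂ] K}
    (hχ : ψ₀.comp χ = ContinuousLinearMap.id ℂ H) (hχ' : χ.comp ψ₀ = ContinuousLinearMap.id ℂ K)
    {X : K →L[ℂ] H} :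
    X ∈ tangentSpaceAt (purifications H σ e) (U.comp ψ₀) ↔
      ∃ η ∈ lieU H, X = (U * η).comp ψ₀ := by
  constructor
  · rintro ⟨γ, hγ, hmem, h0, rfl⟩
    set X := deriv γ 0
    have hd : HasDerivWithinAt γ X univ 0 :=
      ((hγ.differentiable (by simp)).differentiableAt).hasDerivAt.hasDerivWithinAt
    have h1 := hasDerivWithinAt_comp_clm (hasDerivWithinAt_adjoint_clm hd) hd
    have h2 : (fun s => (ContinuousLinearMap.adjoint (γ s)).comp (γ s)) = fun _ => specOp σ e :=
      funext hmem
    rw [h2, h0] at h1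
    have h3 := uniqueDiffWithinAt_univ.eq_deriv _ h1 (hasDerivWithinAt_const 0 univ (specOp σ e))
    have hχs : (ContinuousLinearMap.adjoint χ).comp (ContinuousLinearMap.adjoint ψ₀) =
        ContinuousLinearMap.id ℂ H := by
      rw [← ContinuousLinearMap.adjoint_comp, hχ, ContinuousLinearMap.adjoint_id]
    -- The witness solves `X = U η ψ₀` for `η`. Sandwiching the derivative of `γ† γ = P(σ)` between
    -- `χ†` and `χ` says that `η` is skew-adjoint.
    refine ⟨(star U).comp (X.comp χ), ?_, ?_⟩
    · refine skewAdjoint.mem_iff.2 (eq_neg_of_add_eq_zero_right ?_)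
      have h4 := congrArg (fun A => (ContinuousLinearMap.adjoint χ).comp (A.comp χ)) h3
      simp only [ContinuousLinearMap.zero_comp, ContinuousLinearMap.comp_zero,
        ContinuousLinearMap.add_comp, ContinuousLinearMap.comp_add] at h4
      rw [ContinuousLinearMap.adjoint_comp] at h4
      have e1 : (ContinuousLinearMap.adjoint χ).comp
          ((((ContinuousLinearMap.adjoint ψ₀).comp (ContinuousLinearMap.adjoint U)).comp X).comp
            χ) =
          (star U).comp (X.comp χ) := by
        change ((ContinuousLinearMap.adjoint χ).comp (ContinuousLinearMap.adjoint ψ₀)).comp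
          ((star U).comp (X.comp χ)) = _
        rw [hχs]; rfl
      have e2 : (ContinuousLinearMap.adjoint χ).comp
          (((ContinuousLinearMap.adjoint X).comp (U.comp ψ₀)).comp χ) =
          star ((star U).comp (X.comp χ)) := by
        change (ContinuousLinearMap.adjoint χ).comp ((ContinuousLinearMap.adjoint X).comp
          (U.comp (ψ₀.comp χ))) = ContinuousLinearMap.adjoint _
        rw [hχ, ContinuousLinearMap.adjoint_comp, ContinuousLinearMap.adjoint_comp,
          ContinuousLinearMap.star_eq_adjoint, ContinuousLinearMap.adjoint_adjoint]
        rfl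
      rw [e1, e2] at h4
      exact h4
    · change X = ((U * star U).comp X).comp (χ.comp ψ₀)
      rw [hU', hχ']
      rfl
  · rintro ⟨η, hη, rfl⟩
    let _ : NormedAlgebra ℚ (H →L[ℂ] H) := NormedAlgebra.restrictScalars ℚ ℂ (H →L[ℂ] H)
    have hexp : ∀ s : ℝ, star (NormedSpace.exp (s • η)) * NormedSpace.exp (s • η) = 1 := fun s =>
      (Unitary.mem_iff.1 (NormedSpace.exp_mem_unitary_of_mem_skewAdjoint
        ((skewAdjoint.smul_mem s hη)))).1
    have hsm : ContDiff ℝ ∞ fun s : ℝ => NormedSpace.exp (s • η) := by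
      refine ContDiff.comp (g := NormedSpace.exp) ?_ (contDiff_id.smul contDiff_const)
      exact contDiff_iff_contDiffAt.2 fun x => (NormedSpace.exp_analytic x).contDiffAt
    have hd := hasDerivWithinAt_comp_clm (hasDerivWithinAt_comp_clm
      (hasDerivWithinAt_const 0 univ U)
      (hasDerivAt_exp_smul_const (𝕂 := ℝ) η (0 : ℝ)).hasDerivWithinAt)
      (hasDerivWithinAt_const 0 univ ψ₀)
    refine ⟨fun s => (U.comp (NormedSpace.exp (s • η))).comp ψ₀, ?_, fun s => ?_, ?_, ?_⟩
    · exact contDiffOn_univ.1 (contDiffOn_comp_clm (contDiffOn_comp_clm contDiffOn_const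
        hsm.contDiffOn) contDiffOn_const)
    · refine comp_mem_purifications ?_ hψ₀
      change star (U * _) * (U * _) = 1
      rw [star_mul, mul_assoc, ← mul_assoc (star U), hU, one_mul, hexp]
    · simp only [zero_smul, NormedSpace.exp_zero]
      rfl
    · rw [(hd.hasDerivAt Filter.univ_mem).deriv]
      ext x
      simp

/-- The differential of `π` sends `U η ψ₀` to `U [η, ρ₀] U†`. -/
theorem mem_verticalSpace_comp {U : H →L[ℂ] H} (hU : star U * U = 1)
    (hU' : U * star U = 1) (hψ₀ : ψ₀ ∈ purifications H σ e) {χ : H →L[ℂ] K}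
    (hχ : ψ₀.comp χ = ContinuousLinearMap.id ℂ H) (hχ' : χ.comp ψ₀ = ContinuousLinearMap.id ℂ K)
    {X : K →L[ℂ] H} :
    X ∈ verticalSpace σ e (U.comp ψ₀) ↔
      ∃ η ∈ lieU H, η * bundleProj ψ₀ = bundleProj ψ₀ * η ∧ X = (U * η).comp ψ₀ := by
  have hker : ∀ η ∈ lieU H, fderiv ℝ (bundleProj : (K →L[ℂ] H) → (H →L[ℂ] H)) (U.comp ψ₀)
      ((U * η).comp ψ₀) = 0 ↔ η * bundleProj ψ₀ = bundleProj ψ₀ * η := by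
    intro η hη
    have h : fderiv ℝ (bundleProj : (K →L[ℂ] H) → (H →L[ℂ] H)) (U.comp ψ₀)
        ((U * η).comp ψ₀) = U * (η * bundleProj ψ₀ - bundleProj ψ₀ * η) * star U := by
      rw [fderiv_bundleProj, ContinuousLinearMap.adjoint_comp, ContinuousLinearMap.adjoint_comp]
      change U * bundleProj ψ₀ * star (U * η) + U * η * bundleProj ψ₀ * star U = _
      rw [star_mul, skewAdjoint.mem_iff.1 hη]
      noncomm_ring
    rw [h, ← sub_eq_zero (a := η * _)]
    refine ⟨fun h => ?_, fun h => by rw [h, mul_zero, zero_mul]⟩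
    have h' := congrArg (fun A => star U * A * U) h
    simpa only [mul_assoc, hU, mul_one, mul_zero, zero_mul, ← mul_assoc (star U), one_mul] using h'
  constructor
  · rintro ⟨hT, h0⟩
    obtain ⟨η, hη, rfl⟩ := (mem_tangentSpaceAt_purifications hU hU' hψ₀ hχ hχ').1 hT
    exact ⟨η, hη, (hker η hη).1 h0, rfl⟩
  · rintro ⟨η, hη, h, rfl⟩
    exact ⟨(mem_tangentSpaceAt_purifications hU hU' hψ₀ hχ hχ').2 ⟨η, hη, rfl⟩, (hker η hη).2 h⟩

theorem velocity_mem_lieU {τ : ℝ} (hτ : 0 < τ) {ξ : ℝ → (H →L[ℂ] H)}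
    (hξ : IsCurveIn τ (lieU H) ξ) {t : ℝ} (ht : t ∈ Icc 0 τ) : velocity τ ξ t ∈ lieU H := by
  have hd := (hξ.1.differentiableOn (by simp) t ht).hasDerivWithinAt
  have h1 := hasDerivWithinAt_adjoint_clm hd
  have h2 := hd.neg.congr (f₁ := fun s => ContinuousLinearMap.adjoint (ξ s))
    (fun s hs => skewAdjoint.mem_iff.1 (hξ.2 s hs)) (skewAdjoint.mem_iff.1 (hξ.2 t ht))
  exact skewAdjoint.mem_iff.2 ((uniqueDiffOn_Icc hτ t ht).eq_deriv _ h1 h2)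

end Geometry

/-! ### The metrics `G` and `∗`, and horizontality in terms of `ξ`. -/

section Metric

variable {K : Type*} [NormedAddCommGroup K] [InnerProductSpace ℂ K]
variable {H : Type*} [NormedAddCommGroup H] [InnerProductSpace ℂ H]

variable [FiniteDimensional ℂ H]

/-- The real part of the trace. -/
noncomputable def reTrace (H : Type*) [NormedAddCommGroup H] [InnerProductSpace ℂ H]
    [FiniteDimensional ℂ H] : (H →L[ℂ] H) →L[ℝ] ℝ :=
  Complex.reCLM.comp ((LinearMap.toContinuousLinearMap
    (LinearMap.trace ℂ H ∘ₗ ContinuousLinearMap.coeLM ℂ)).restrictScalars ℝ)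

theorem reTrace_mul_comm (A B : H →L[ℂ] H) : reTrace H (A * B) = reTrace H (B * A) :=
  congrArg Complex.re (LinearMap.trace_mul_comm ℂ (A : H →ₗ[ℂ] H) (B : H →ₗ[ℂ] H))

theorem starMetric_eq (ρ₀ ξ η : H →L[ℂ] H) :
    starMetric ρ₀ ξ η = -(1 / 2) * reTrace H ((ξ * η + η * ξ) * ρ₀) := rfl

/-- The symmetrized product of `ξ` and `[ξ, η]` is `[ξ², η]`, whose trace against `ρ₀` vanishes by
cyclicity when `η` commutes with `ρ₀`. This is the infinitesimal conservation law. -/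
theorem starMetric_lie_self_eq_zero {ρ₀ ξ η : H →L[ℂ] H} (h : η * ρ₀ = ρ₀ * η) :
    starMetric ρ₀ ξ ⁅ξ, η⁆ = 0 := by
  have h1 : (ξ * ⁅ξ, η⁆ + ⁅ξ, η⁆ * ξ) * ρ₀ = ξ * ξ * ρ₀ * η - η * (ξ * ξ * ρ₀) := by
    rw [Ring.lie_def, mul_assoc (ξ * ξ), ← h]
    noncomm_ring
  rw [starMetric_eq, h1, map_sub, reTrace_mul_comm _ η, sub_self, mul_zero]

theorem hasDerivWithinAt_starMetric (ρ₀ η : H →L[ℂ] H) {ξ : ℝ → (H →L[ℂ] H)} {ξ' : H →L[ℂ] H}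
    {s : Set ℝ} {t : ℝ} (h : HasDerivWithinAt ξ ξ' s t) :
    HasDerivWithinAt (fun t => starMetric ρ₀ (ξ t) η) (starMetric ρ₀ ξ' η) s t := by
  have hc : ∀ A : H →L[ℂ] H, HasDerivWithinAt (fun _ => A) 0 s t := hasDerivWithinAt_const t s
  have h1 := hasDerivWithinAt_comp_clm ((hasDerivWithinAt_comp_clm h (hc η)).add
    (hasDerivWithinAt_comp_clm (hc η) h)) (hc ρ₀)
  have h2 := (((reTrace H).hasFDerivAt).comp_hasDerivWithinAt t h1).const_mul (-(1 / 2) : ℝ)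
  refine h2.congr_deriv ?_
  rw [starMetric_eq]
  congr 2
  simp only [ContinuousLinearMap.comp_zero, ContinuousLinearMap.zero_comp, zero_add, add_zero]
  rfl

variable [CompleteSpace K] [CompleteSpace H] [FiniteDimensional ℂ K]

/-- `U` cancels by unitarity, and cyclicity turns the trace on `K` into a trace on `H` against `ρ₀ =
ψ₀ ψ₀†`. -/
theorem hsMetric_comp {U : H →L[ℂ] H} (hU : star U * U = 1) (ψ₀ : K →L[ℂ] H)
    (C D : H →L[ℂ] H) :
    hsMetric ((U * C).comp ψ₀) ((U * D).comp ψ₀) =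
      (1 / 2) * reTrace H ((star C * D + star D * C) * bundleProj ψ₀) := by
  have key : ∀ A B : H →L[ℂ] H, (ContinuousLinearMap.adjoint ((U * A).comp ψ₀)).comp
      ((U * B).comp ψ₀) = (ContinuousLinearMap.adjoint ψ₀).comp ((star A * B).comp ψ₀) := by
    intro A B
    rw [ContinuousLinearMap.adjoint_comp]
    change (ContinuousLinearMap.adjoint ψ₀).comp ((star (U * A) * (U * B)).comp ψ₀) = _
    rw [star_mul, mul_assoc, ← mul_assoc (star U), hU, one_mul]
  have htr : LinearMap.trace ℂ K ((((ContinuousLinearMap.adjoint ψ₀).comp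
      ((star C * D + star D * C).comp ψ₀) : K →L[ℂ] K)) : K →ₗ[ℂ] K) =
      LinearMap.trace ℂ H
        ((((star C * D + star D * C) * bundleProj ψ₀ : H →L[ℂ] H)) : H →ₗ[ℂ] H) :=
    (LinearMap.trace_comp_comm' (R := ℂ) ((ContinuousLinearMap.adjoint ψ₀ : H →L[ℂ] K) : H →ₗ[ℂ] K)
      (((star C * D + star D * C).comp ψ₀ : K →L[ℂ] H) : K →ₗ[ℂ] H)).symm
  rw [hsMetric, key, key, ← ContinuousLinearMap.comp_add, ← ContinuousLinearMap.add_comp, htr]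
  rfl

theorem hsMetric_comp_eq_starMetric {U : H →L[ℂ] H} (hU : star U * U = 1) (ψ₀ : K →L[ℂ] H)
    {ξ η : H →L[ℂ] H} (hξ : ξ ∈ lieU H) (hη : η ∈ lieU H) :
    hsMetric ((U * ξ).comp ψ₀) ((U * η).comp ψ₀) = starMetric (bundleProj ψ₀) ξ η := by
  rw [hsMetric_comp hU, starMetric_eq, skewAdjoint.mem_iff.1 hξ, skewAdjoint.mem_iff.1 hη,
    neg_mul, neg_mul, ← neg_add, neg_mul, map_neg]
  ring

/-- Since `ξ²` is self-adjoint, it contributes `[ξ², η]`, which is the symmetrized product of `ξ`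
and `[ξ, η]`. -/
theorem hsMetric_comp_acceleration {U : H →L[ℂ] H} (hU : star U * U = 1) (ψ₀ : K →L[ℂ] H)
    {ξ ζ η : H →L[ℂ] H} (hξ : ξ ∈ lieU H) (hζ : ζ ∈ lieU H) (hη : η ∈ lieU H) :
    hsMetric ((U * (ξ * ξ + ζ)).comp ψ₀) ((U * η).comp ψ₀) =
      starMetric (bundleProj ψ₀) ζ η - starMetric (bundleProj ψ₀) ξ ⁅ξ, η⁆ := by
  rw [hsMetric_comp hU, starMetric_eq, starMetric_eq, star_add, star_mul,
    skewAdjoint.mem_iff.1 hξ, skewAdjoint.mem_iff.1 hη, skewAdjoint.mem_iff.1 hζ, Ring.lie_def]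
  have h : (((-ξ * -ξ + -ζ) * η + -η * (ξ * ξ + ζ)) * bundleProj ψ₀) =
      -((ζ * η + η * ζ) * bundleProj ψ₀) +
        (ξ * (ξ * η - η * ξ) + (ξ * η - η * ξ) * ξ) * bundleProj ψ₀ := by
    noncomm_ring
  rw [h, map_add, map_neg]
  ring

variable {σ : Spectrum} {e : OrthonormalBasis (Fin σ.rank) ℂ K} {ψ₀ : K →L[ℂ] H}

/-- The resulting condition does not involve `U`, so horizontality at different times can be
compared in `u(H)`. -/
theorem mem_horizontalSpace_comp {U : H →L[ℂ] H} (hU : star U * U = 1)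
    (hU' : U * star U = 1) (hψ₀ : ψ₀ ∈ purifications H σ e) {χ : H →L[ℂ] K}
    (hχ : ψ₀.comp χ = ContinuousLinearMap.id ℂ H) (hχ' : χ.comp ψ₀ = ContinuousLinearMap.id ℂ K)
    {ξ : H →L[ℂ] H} (hξ : ξ ∈ lieU H) :
    (U * ξ).comp ψ₀ ∈ horizontalSpace σ e (U.comp ψ₀) ↔
      ∀ η ∈ lieU H, η * bundleProj ψ₀ = bundleProj ψ₀ * η →
        starMetric (bundleProj ψ₀) ξ η = 0 := by
  constructor
  · rintro ⟨-, h⟩ η hη hcomm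
    rw [← hsMetric_comp_eq_starMetric hU ψ₀ hξ hη]
    exact h _ ((mem_verticalSpace_comp hU hU' hψ₀ hχ hχ').2 ⟨η, hη, hcomm, rfl⟩)
  · intro h
    refine ⟨(mem_tangentSpaceAt_purifications hU hU' hψ₀ hχ hχ').2 ⟨ξ, hξ, rfl⟩, fun Y hY => ?_⟩
    obtain ⟨η, hη, hcomm, rfl⟩ := (mem_verticalSpace_comp hU hU' hψ₀ hχ hχ').1 hY
    rw [hsMetric_comp_eq_starMetric hU ψ₀ hξ hη]
    exact h η hη hcomm

end Metric

/-! ### Curves `U ψ₀`: generators, conservation law, geodesics. -/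

section Curves

variable {K : Type*} [NormedAddCommGroup K] [InnerProductSpace ℂ K]
variable {H : Type*} [NormedAddCommGroup H] [InnerProductSpace ℂ H] [CompleteSpace H]
variable {ψ₀ : K →L[ℂ] H}
variable {τ : ℝ} {ξ : ℝ → (H →L[ℂ] H)} {ψ : ℝ → (K →L[ℂ] H)}

theorem velocity_eq_expNeg_comp (hτ : 0 < τ) (hξ : IsCurveIn τ (lieU H) ξ)
    (hψ : EqOn ψ (fun t => (expNeg ξ t).comp ψ₀) (Icc 0 τ)) {t : ℝ} (ht : t ∈ Icc 0 τ) :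
    velocity τ ψ t = (expNeg ξ t * ξ t).comp ψ₀ :=
  ((hasDerivWithinAt_expNeg_comp hτ hξ ψ₀ ht).congr hψ (hψ ht)).derivWithin
    (uniqueDiffOn_Icc hτ t ht)

theorem velocity_velocity_eq_expNeg_comp (hτ : 0 < τ) (hξ : IsCurveIn τ (lieU H) ξ)
    (hψ : EqOn ψ (fun t => (expNeg ξ t).comp ψ₀) (Icc 0 τ)) {t : ℝ} (ht : t ∈ Icc 0 τ) :
    velocity τ (velocity τ ψ) t =
      (expNeg ξ t * (ξ t * ξ t + velocity τ ξ t)).comp ψ₀ := by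
  have hd := (hξ.1.differentiableOn (by simp) t ht).hasDerivWithinAt
  have h := hasDerivWithinAt_comp_clm (hasDerivWithinAt_comp_clm
    (hasDerivWithinAt_expNeg hτ.le hξ.1.continuousOn ht) hd)
    (hasDerivWithinAt_const t (Icc 0 τ) ψ₀)
  have hv := fun s hs => velocity_eq_expNeg_comp hτ hξ hψ (t := s) hs
  refine ((h.congr hv (hv t ht)).derivWithin (uniqueDiffOn_Icc hτ t ht)).trans ?_
  rw [ContinuousLinearMap.comp_zero, zero_add]
  change (expNeg ξ t * velocity τ ξ t + expNeg ξ t * ξ t * ξ t).comp ψ₀ = _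
  congr 1
  noncomm_ring

variable [CompleteSpace K] [FiniteDimensional ℂ H]
variable {σ : Spectrum} {e : OrthonormalBasis (Fin σ.rank) ℂ K}

theorem isCurveIn_purifications (hτ : 0 < τ) (hξ : IsCurveIn τ (lieU H) ξ)
    (hψ₀ : ψ₀ ∈ purifications H σ e) (hψ : EqOn ψ (fun t => (expNeg ξ t).comp ψ₀) (Icc 0 τ)) :
    IsCurveIn τ (purifications H σ e) ψ := by
  refine ⟨(contDiffOn_comp_clm (contDiffOn_expNeg hτ hξ.1) contDiffOn_const).congr hψ,
    fun t ht => ?_⟩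
  rw [hψ ht]
  exact comp_mem_purifications (star_mul_expNeg hτ hξ ht) hψ₀

theorem exists_generator (hτ : 0 < τ) (hψ₀ : ψ₀ ∈ purifications H σ e)
    (hinv : IsUnit (bundleProj ψ₀)) (hψ : IsCurveIn τ (purifications H σ e) ψ)
    (hψ0 : ψ 0 = ψ₀) :
    ∃ ξ : ℝ → (H →L[ℂ] H), IsCurveIn τ (lieU H) ξ ∧
      EqOn ψ (fun t => (expNeg ξ t).comp ψ₀) (Icc 0 τ) := by
  obtain ⟨χ, hχ', hχ⟩ := exists_inverse_of_isUnit_bundleProj hψ₀ hinv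
  have hχs : (ContinuousLinearMap.adjoint χ).comp (ContinuousLinearMap.adjoint ψ₀) =
      ContinuousLinearMap.id ℂ H := by
    rw [← ContinuousLinearMap.adjoint_comp, hχ, ContinuousLinearMap.adjoint_id]
  -- Here `χ = ψ₀⁻¹`. `W` is unitary because `ψ† ψ` stays equal to `ψ₀† ψ₀`.
  let W : ℝ → (H →L[ℂ] H) := fun t => (ψ t).comp χ
  have hW : ContDiffOn ℝ ∞ W (Icc 0 τ) := contDiffOn_comp_clm hψ.1 contDiffOn_const
  have hWW : ∀ t ∈ Icc 0 τ, star (W t) * W t = 1 := fun t ht => by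
    have hP : (ContinuousLinearMap.adjoint (ψ t)).comp (ψ t) =
        (ContinuousLinearMap.adjoint ψ₀).comp ψ₀ := (hψ.2 t ht).trans (Eq.symm hψ₀)
    change (ContinuousLinearMap.adjoint ((ψ t).comp χ)).comp ((ψ t).comp χ) = _
    rw [ContinuousLinearMap.adjoint_comp]
    change (ContinuousLinearMap.adjoint χ).comp
      (((ContinuousLinearMap.adjoint (ψ t)).comp (ψ t)).comp χ) = _
    rw [hP]
    change ((ContinuousLinearMap.adjoint χ).comp (ContinuousLinearMap.adjoint ψ₀)).comp
      (ψ₀.comp χ) = _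
    rw [hχs, hχ]
    rfl
  have hWW' : ∀ t ∈ Icc 0 τ, W t * star (W t) = 1 := fun t ht => by
    have h := congrArg ContinuousLinearMap.toLinearMap (hWW t ht)
    exact ContinuousLinearMap.coe_injective (mul_eq_one_comm.1 h)
  have hWd := fun t (ht : t ∈ Icc 0 τ) => (hW.differentiableOn (by simp) t ht).hasDerivWithinAt
  have hξ : IsCurveIn τ (lieU H) fun t => star (W t) * velocity τ W t := by
    refine ⟨contDiffOn_comp_clm (contDiffOn_adjoint_clm hW)
      ((contDiffOn_infty_iff_derivWithin (uniqueDiffOn_Icc hτ)).1 hW).2, fun t ht => ?_⟩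
    have h1 := hasDerivWithinAt_comp_clm (hasDerivWithinAt_adjoint_clm (hWd t ht)) (hWd t ht)
    have h2 := (hasDerivWithinAt_const t (Icc 0 τ) (1 : H →L[ℂ] H)).congr
      (f₁ := fun s => (ContinuousLinearMap.adjoint (W s)).comp (W s)) hWW (hWW t ht)
    have h3 := (uniqueDiffOn_Icc hτ t ht).eq_deriv _ h1 h2
    refine skewAdjoint.mem_iff.2 (eq_neg_of_add_eq_zero_right ?_)
    rw [star_mul, star_star]
    exact h3
  refine ⟨_, hξ, fun t ht => ?_⟩
  have hW0 : W 0 = 1 := by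
    change (ψ 0).comp χ = 1
    rw [hψ0, hχ]
    rfl
  have h := eq_expNeg_of_hasDerivWithinAt hτ hξ (W := W) (fun t ht => (hWd t ht).congr_deriv (by
    rw [← mul_assoc, hWW' t ht, one_mul]
    rfl)) hW0 ht
  change ψ t = ContinuousLinearMap.comp (expNeg _ t) ψ₀
  rw [← h]
  change ψ t = (ψ t).comp (χ.comp ψ₀)
  rw [hχ']
  rfl

/-- Noether's theorem for the symmetries of `ρ₀`: the derivative of `ξ ∗ η` is `ξ ∗ [ξ, η]`, which
is zero. -/
theorem starMetric_eq_of_eulerArnold (hτ : 0 < τ) (hξ : IsCurveIn τ (lieU H) ξ)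
    {ρ₀ η : H →L[ℂ] H} (hE : EulerArnold τ ρ₀ ξ) (hη : η ∈ lieU H) (hcomm : η * ρ₀ = ρ₀ * η)
    {t : ℝ} (ht : t ∈ Icc 0 τ) : starMetric ρ₀ (ξ t) η = starMetric ρ₀ (ξ 0) η := by
  refine eq_of_derivWithin_eq_zero (f := fun t => starMetric ρ₀ (ξ t) η) hτ (fun t ht => ?_) ht
  have hd := (hξ.1.differentiableOn (by simp) t ht).hasDerivWithinAt
  refine (hasDerivWithinAt_starMetric ρ₀ η hd).congr_deriv ?_
  exact ((hE t ht).2 η hη).trans (starMetric_lie_self_eq_zero hcomm)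

variable [FiniteDimensional ℂ K]

theorem isGeodesic_iff_eulerArnold (hτ : 0 < τ) (hξ : IsCurveIn τ (lieU H) ξ)
    (hψ₀ : ψ₀ ∈ purifications H σ e) (hinv : IsUnit (bundleProj ψ₀))
    (hψ : EqOn ψ (fun t => (expNeg ξ t).comp ψ₀) (Icc 0 τ)) :
    IsGeodesic τ (purifications H σ e) ψ ↔ EulerArnold τ (bundleProj ψ₀) ξ := by
  obtain ⟨χ, hχ', hχ⟩ := exists_inverse_of_isUnit_bundleProj hψ₀ hinv
  have htan := fun t (ht : t ∈ Icc 0 τ) (X : K →L[ℂ] H) =>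
    mem_tangentSpaceAt_purifications (X := X) (star_mul_expNeg hτ hξ ht)
      (expNeg_mul_star hτ hξ ht) hψ₀ hχ hχ'
  rw [IsGeodesic, and_iff_right (isCurveIn_purifications hτ hξ hψ₀ hψ)]
  refine forall₂_congr fun t ht => ?_
  have hacc := fun η (hη : η ∈ lieU H) => hsMetric_comp_acceleration (star_mul_expNeg hτ hξ ht) ψ₀
    (hξ.2 t ht) (velocity_mem_lieU hτ hξ ht) hη
  rw [IsAdStar, and_iff_right (velocity_mem_lieU hτ hξ ht), hψ ht, and_iff_right
    ((htan t ht 0).2 ⟨0, (skewAdjoint (H →L[ℂ] H)).zero_mem, by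
      rw [mul_zero, ContinuousLinearMap.zero_comp]⟩), sub_zero,
    velocity_velocity_eq_expNeg_comp hτ hξ hψ ht]
  constructor
  -- By `hacc`, orthogonality of the acceleration to all tangent vectors is the weak form of the
  -- Euler–Arnold equation.
  · intro h η hη
    rw [← sub_eq_zero, ← hacc η hη]
    exact h _ ((htan t ht _).2 ⟨η, hη, rfl⟩)
  · intro h Y hY
    obtain ⟨η, hη, rfl⟩ := (htan t ht _).1 hY
    rw [hacc η hη, h η hη, sub_self]

theorem isHorizontalGeodesic_iff (hτ : 0 < τ) (hξ : IsCurveIn τ (lieU H) ξ)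
    (hψ₀ : ψ₀ ∈ purifications H σ e) (hinv : IsUnit (bundleProj ψ₀))
    (hψ : EqOn ψ (fun t => (expNeg ξ t).comp ψ₀) (Icc 0 τ)) :
    IsHorizontalGeodesic τ σ e ψ ↔
      EulerArnold τ (bundleProj ψ₀) ξ ∧ fundField (ξ 0) ψ₀ ∈ horizontalSpace σ e ψ₀ := by
  have h0 : (0 : ℝ) ∈ Icc 0 τ := ⟨le_rfl, hτ.le⟩
  obtain ⟨χ, hχ', hχ⟩ := exists_inverse_of_isUnit_bundleProj hψ₀ hinv
  rw [IsHorizontalGeodesic, isGeodesic_iff_eulerArnold hτ hξ hψ₀ hinv hψ]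
  refine and_congr_right fun hE => ?_
  have hhor := fun t (ht : t ∈ Icc 0 τ) => mem_horizontalSpace_comp (star_mul_expNeg hτ hξ ht)
    (expNeg_mul_star hτ hξ ht) hψ₀ hχ hχ' (hξ.2 t ht)
  -- As `U 0 = 1`, the initial condition is the instance `t = 0` of horizontality along the curve.
  have hinit : fundField (ξ 0) ψ₀ ∈ horizontalSpace σ e ψ₀ ↔
      (expNeg ξ 0 * ξ 0).comp ψ₀ ∈ horizontalSpace σ e ((expNeg ξ 0).comp ψ₀) := by
    rw [fundField_eq, expNeg_zero, one_mul]
    rfl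
  rw [hinit, hhor 0 h0]
  have hvel : (∀ t ∈ Icc 0 τ, velocity τ ψ t ∈ horizontalSpace σ e (ψ t)) ↔
      ∀ t ∈ Icc 0 τ, ∀ η ∈ lieU H, η * bundleProj ψ₀ = bundleProj ψ₀ * η →
        starMetric (bundleProj ψ₀) (ξ t) η = 0 := by
    refine forall₂_congr fun t ht => ?_
    rw [velocity_eq_expNeg_comp hτ hξ hψ ht, hψ ht]
    exact hhor t ht
  rw [hvel]
  refine ⟨fun h => h 0 h0, fun h t ht η hη hcomm => ?_⟩
  rw [starMetric_eq_of_eulerArnold hτ hξ hE hη hcomm ht]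
  exact h η hη hcomm

end Curves

end LabelGeodesics

/-! ### The theorem. -/

open LabelGeodesics

theorem theorem6
    {K : Type*} [NormedAddCommGroup K] [InnerProductSpace ℂ K] [CompleteSpace K]
    {H : Type*} [NormedAddCommGroup H] [InnerProductSpace ℂ H] [CompleteSpace H]
    [FiniteDimensional ℂ H]
    (σ : Spectrum) (e : OrthonormalBasis (Fin σ.rank) ℂ K)
    (ℏ : ℝ) (hℏ : 0 < ℏ) (τ : ℝ) (hτ : 0 < τ)
    (ψ₀ : K →L[ℂ] H) (hψ₀ : ψ₀ ∈ purifications H σ e)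
    (hinv : IsUnit (bundleProj ψ₀)) :
    -- every curve in `S(σ)` that extends from `ψ₀` is a solution for some curve `ξ` in `u(H)`
    (∀ ψ : ℝ → (K →L[ℂ] H), IsCurveIn τ (purifications H σ e) ψ → ψ 0 = ψ₀ →
      ∃ ξ : ℝ → (H →L[ℂ] H), IsCurveIn τ (lieU H) ξ ∧
        SolvesSchrodinger ℏ τ (hamiltonian ℏ ξ) ψ₀ ψ) ∧
    (∀ ξ : ℝ → (H →L[ℂ] H), IsCurveIn τ (lieU H) ξ →
      -- there is precisely one solution for `ξ`, and it is a curve in `S(σ)`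
      (∃ ψ : ℝ → (K →L[ℂ] H), SolvesSchrodinger ℏ τ (hamiltonian ℏ ξ) ψ₀ ψ ∧
        IsCurveIn τ (purifications H σ e) ψ ∧
        ∀ φ : ℝ → (K →L[ℂ] H), SolvesSchrodinger ℏ τ (hamiltonian ℏ ξ) ψ₀ φ →
          Set.EqOn φ ψ (Set.Icc 0 τ)) ∧
      -- the solution is a horizontal geodesic iff the two conditions on `ξ` hold
      (∀ ψ : ℝ → (K →L[ℂ] H), SolvesSchrodinger ℏ τ (hamiltonian ℏ ξ) ψ₀ ψ →
        (IsHorizontalGeodesic τ σ e ψ ↔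
          EulerArnold τ (bundleProj ψ₀) ξ ∧
            fundField (ξ 0) ψ₀ ∈ horizontalSpace σ e ψ₀))) := by
  have : FiniteDimensional ℂ K := e.toBasis.finiteDimensional_of_finite
  refine ⟨fun ψ hψ hψ0 => ?_, fun ξ hξ => ⟨?_, fun ψ hψ => ?_⟩⟩
  · obtain ⟨ξ, hξ, h⟩ := exists_generator hτ hψ₀ hinv hψ hψ0
    exact ⟨ξ, hξ, (solvesSchrodinger_iff hℏ hτ hξ ψ₀ ψ).2 h⟩
  · refine ⟨fun t => (expNeg ξ t).comp ψ₀, (solvesSchrodinger_iff hℏ hτ hξ ψ₀ _).2 fun _ _ => rfl,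
      isCurveIn_purifications hτ hξ hψ₀ fun _ _ => rfl,
      fun φ hφ => (solvesSchrodinger_iff hℏ hτ hξ ψ₀ φ).1 hφ⟩
  · exact isHorizontalGeodesic_iff hτ hξ hψ₀ hinv ((solvesSchrodinger_iff hℏ hτ hξ ψ₀ ψ).1 hψ)
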